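/- Let $\Theta$ be the set of continuous functions $\theta:\mathbb R\to\mathbb R$ with $\theta(0)=0$ and $\lim_{|x|\to\infty}x^{-2}\theta(x)=0$, let $\mathcal B$ be the $\sigma$-field on $\Theta$ generated by the evaluations $\theta\mapsto\theta(x)$, $x\in\mathbb R$, and let $\mathcal W$ be the two-sided Wiener measure on $(\Theta,\mathcal B)$, i.e. the probability measure under which $(\theta(x))_{x\ge 0}$ and $(\theta(-x))_{x\ge 0}$ are two independent standard Brownian motions. For $t\in\mathbb R$ define $T_t:\Theta\to\Theta$ by $$T_t\theta(x)=e^{-t/4}\,\theta(e^{t/2}x),\qquad x\in\mathbb R.$$ Then $(T_t)_{t\in\mathbb R}$ is a measurable flow (the map $(t,\theta)\mapsto T_t\theta$ is measurable, $T_0=\mathrm{id}$ and $T_{s+t}=T_s\circ T_t$), each $T_t$ preserves $\mathcal W$, and the dynamical system $(\Theta,\mathcal B,\mathcal W,(T_t)_{t\in\mathbb R})$ is ergodic: if $A\in\mathcal B$ satisfies $\mathcal W(T_t^{-1}(A)\,\triangle\,A)=0$ for every $t\in\mathbb R$, then $\mathcal W(A)\in\{0,1\}$. Moreover, for every fixed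 $t\ne 0$ the single transformation $T_t$ is ergodic: if $A\in\mathcal B$ and $T_t^{-1}(A)=A$, then $\mathcal W(A)\in\{0,1\}$. -/

import Mathlib

open MeasureTheory ProbabilityTheory Filter Topology
open scoped NNReal

/-- The path space `Θ`: continuous functions `θ : ℝ → ℝ` with `θ 0 = 0` and
`θ x / x ^ 2 → 0` as `|x| → ∞` (on `ℝ`, the filter `cocompact ℝ` is `|x| → ∞`). -/
structure PathSpace where
  toFun : ℝ → ℝ
  continuous_toFun : Continuous toFun
  map_zero_toFun : toFun 0 = 0
  tendsto_div_sq : Tendsto (fun x => toFun x / x ^ 2) (cocompact ℝ) (𝓝 0)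

namespace PathSpace

instance : FunLike PathSpace ℝ ℝ where
  coe := toFun
  coe_injective θ η h := by cases θ; cases η; congr

@[ext]
theorem ext {θ η : PathSpace} (h : ∀ x, θ x = η x) : θ = η := DFunLike.ext _ _ h

/-- The σ-field generated by the cylinder sets, i.e. by the evaluations `θ ↦ θ x`, `x : ℝ`. -/
instance : MeasurableSpace PathSpace :=
  ⨆ x : ℝ, MeasurableSpace.comap (fun θ : PathSpace => θ x) inferInstance

/-- The Brownian scaling transformation `T_t θ (x) = e^{-t/4} θ(e^{t/2} x)`. -/
noncomputable def scale (t : ℝ) (θ : PathSpace) : PathSpace where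
  toFun x := Real.exp (-t / 4) * θ (Real.exp (t / 2) * x)
  continuous_toFun :=
    continuous_const.mul (θ.continuous_toFun.comp (continuous_const.mul continuous_id))
  map_zero_toFun := by
    have h : θ 0 = 0 := θ.map_zero_toFun
    simp [h]
  tendsto_div_sq := by
    have hc : Real.exp (t / 2) ≠ 0 := (Real.exp_pos _).ne'
    have h1 : Tendsto (fun x : ℝ => Real.exp (t / 2) * x) (cocompact ℝ) (cocompact ℝ) :=
      (Homeomorph.mulLeft₀ _ hc).isClosedEmbedding.tendsto_cocompact
    have h2 := (θ.tendsto_div_sq.comp h1).const_mul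
      (Real.exp (-t / 4) * Real.exp (t / 2) ^ 2)
    rw [mul_zero] at h2
    refine h2.congr fun x => ?_
    change _ * (θ _ / _) = _
    rw [mul_pow]
    rcases eq_or_ne x 0 with rfl | hx
    · simp
    · field_simp

theorem scale_apply (t : ℝ) (θ : PathSpace) (x : ℝ) :
    scale t θ x = Real.exp (-t / 4) * θ (Real.exp (t / 2) * x) := rfl

/-- The transformations `T_t`, `t : ℝ`, form a one-parameter group acting on `Θ`:
`T_0 = id` and `T_{s+t} = T_s ∘ T_t`. -/
noncomputable instance : AddAction ℝ PathSpace where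
  vadd := scale
  zero_vadd θ := by
    ext x
    change scale 0 θ x = θ x
    simp [scale_apply]
  add_vadd s t θ := by
    ext x
    change scale (s + t) θ x = scale s (scale t θ) x
    simp only [scale_apply]
    rw [← mul_assoc, ← Real.exp_add, ← mul_assoc, ← Real.exp_add]
    congr 2
    · ring
    · congr 2; ring

theorem vadd_eq_scale (t : ℝ) (θ : PathSpace) : t +ᵥ θ = scale t θ := rfl

end PathSpace

/-- `W` is the (two-sided) Wiener measure on `Θ`: the probability measure under which
`(θ x)_{x ≥ 0}` and `(θ (-x))_{x ≥ 0}` are two independent standard Brownian motions. -/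
structure IsWienerMeasure (W : Measure PathSpace) : Prop where
  isProbabilityMeasure : IsProbabilityMeasure W
  isBrownian_pos : IsBrownianReal (fun (x : ℝ≥0) (θ : PathSpace) => θ (x : ℝ)) W
  isBrownian_neg : IsBrownianReal (fun (x : ℝ≥0) (θ : PathSpace) => θ (-(x : ℝ))) W
  indep : IndepFun (fun (θ : PathSpace) (x : ℝ≥0) => θ (x : ℝ))
    (fun (θ : PathSpace) (x : ℝ≥0) => θ (-(x : ℝ))) W

/-!
Brownian scaling preserves the finite-dimensional laws of Brownian motion on each half-line, hence
Wiener measure, because a path is determined by its two halves and these are independent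
(`PathSpace.measurePreserving_scale`). Joint measurability of the flow holds since
`(x, θ) ↦ θ x` is continuous in `x` and measurable in `θ`.

Ergodicity of a single `T_t` is a zero-one law. As `T_t` and `T_{-t}` have the same invariant sets,
one may take `t < 0`, so that the time change `x ↦ e^{t/2} x` contracts. Let `A` be invariant.
It is approximated in measure by events depending on the path on some `[-n, n]` only; applying
`T_t^{-j}` with `j` large, it is equally well approximated by events depending on the path on
`[-r, r]`, for `r` as small as desired. By the weak Markov property on each half-line and the
independence of the two halves, these events are independent of all the outward increments beyond
`±r` (`PathSpace.indep_inner_outer`). Hence `A` is independent of the increments beyond `±r` for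
every `r > 0`. Since paths are continuous and vanish at `0`, these increments generate the whole
σ-field as `r` decreases to `0` (`PathSpace.iSup_outer`), so `A` is independent of itself and has
measure `0` or `1`. The abstract part of this argument is
`MeasureTheory.MeasurePreserving.preErgodic_of_indep`.

Ergodicity of the flow follows from that of `T_1`.
-/

/-! ### A zero-one law from asymptotic independence -/

/-- If `a₁, a₂ ≤ m₁` and `b₁, b₂ ≤ m₂` with `m₁` independent of `m₂`, then independence inside each
of the two blocks (`a₁` of `a₂`, `b₁` of `b₂`) gives independence across the blocks. -/
theorem ProbabilityTheory.Indep.sup_sup {Ω : Type*} {m₁ m₂ a₁ a₂ b₁ b₂ : MeasurableSpace Ω}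
    {m : MeasurableSpace Ω} {μ : Measure Ω} [IsZeroOrProbabilityMeasure μ] (h : Indep m₁ m₂ μ)
    (h₁ : m₁ ≤ m) (h₂ : m₂ ≤ m) (ha₁ : a₁ ≤ m₁) (ha₂ : a₂ ≤ m₁) (hb₁ : b₁ ≤ m₂) (hb₂ : b₂ ≤ m₂)
    (ha : Indep a₁ a₂ μ) (hb : Indep b₁ b₂ μ) : Indep (a₁ ⊔ b₁) (a₂ ⊔ b₂) μ := by
  -- the rectangles `s ∩ t` form a π-system generating the supremum of two σ-fields
  have hpi (a b : MeasurableSpace Ω) : IsPiSystem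
      (Set.image2 (· ∩ ·) {s | MeasurableSet[a] s} {t | MeasurableSet[b] t}) := by
    rintro _ ⟨s, hs, t, ht, rfl⟩ _ ⟨s', hs', t', ht', rfl⟩ -
    exact ⟨s ∩ s', hs.inter hs', t ∩ t', ht.inter ht', Set.inter_inter_inter_comm _ _ _ _⟩
  have hgen (a b : MeasurableSpace Ω) : a ⊔ b = MeasurableSpace.generateFrom
      (Set.image2 (· ∩ ·) {s | MeasurableSet[a] s} {t | MeasurableSet[b] t}) := by
    refine le_antisymm (sup_le (fun s hs => ?_) (fun t ht => ?_))
      (MeasurableSpace.generateFrom_le ?_)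
    · exact MeasurableSpace.measurableSet_generateFrom
        ⟨s, hs, Set.univ, MeasurableSet.univ, Set.inter_univ s⟩
    · exact MeasurableSpace.measurableSet_generateFrom
        ⟨Set.univ, MeasurableSet.univ, t, ht, Set.univ_inter t⟩
    · rintro _ ⟨s, hs, t, ht, rfl⟩
      exact (le_sup_left (a := a) s hs).inter (le_sup_right (a := a) t ht)
  refine IndepSets.indep (sup_le (ha₁.trans h₁) (hb₁.trans h₂))
    (sup_le (ha₂.trans h₁) (hb₂.trans h₂)) (hpi _ _) (hpi _ _) (hgen _ _) (hgen _ _) ?_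
  rw [IndepSets_iff]
  rintro _ _ ⟨s, hs, t, ht, rfl⟩ ⟨s', hs', t', ht', rfl⟩
  rw [Indep_iff] at h ha hb
  rw [Set.inter_inter_inter_comm, h _ _ ((ha₁ s hs).inter (ha₂ s' hs'))
    ((hb₁ t ht).inter (hb₂ t' ht')), h _ _ (ha₁ s hs) (hb₁ t ht), h _ _ (ha₂ s' hs') (hb₂ t' ht'),
    ha _ _ hs hs', hb _ _ ht ht', mul_mul_mul_comm]

/-- A measurable set is approximated in measure by sets from an increasing sequence of σ-fields that
generates the whole σ-field. -/
theorem MeasureTheory.exists_measurableSet_measure_symmDiff_lt {Ω : Type*} {m : MeasurableSpace Ω}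
    {μ : Measure Ω} [IsFiniteMeasure μ] {F : ℕ → MeasurableSpace Ω} (hF : Monotone F)
    (hFm : ⨆ n, F n = m) {s : Set Ω} (hs : MeasurableSet s) {ε : ENNReal} (hε : 0 < ε) :
    ∃ n t, MeasurableSet[F n] t ∧ μ (symmDiff t s) < ε := by
  have hring : IsSetRing {t | ∃ n, MeasurableSet[F n] t} := by
    refine ⟨⟨0, @MeasurableSet.empty _ (F 0)⟩, ?_, ?_⟩
    · rintro a b ⟨i, hi⟩ ⟨j, hj⟩
      exact ⟨max i j, MeasurableSet.union (m := F (max i j)) (hF (le_max_left i j) a hi)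
        (hF (le_max_right i j) b hj)⟩
    · rintro a b ⟨i, hi⟩ ⟨j, hj⟩
      exact ⟨max i j, MeasurableSet.diff (m := F (max i j)) (hF (le_max_left i j) a hi)
        (hF (le_max_right i j) b hj)⟩
  have hgen : m = MeasurableSpace.generateFrom {t | ∃ n, MeasurableSet[F n] t} := by
    rw [← hFm, ← MeasurableSpace.generateFrom_iUnion_measurableSet, Set.iUnion_ofPred]
  obtain ⟨t, ⟨n, ht⟩, h⟩ := exists_measure_symmDiff_lt_of_generateFrom_isSetRing (μ := μ) hring
    ⟨{Set.univ}, Set.countable_singleton _, by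
      rintro _ rfl
      exact ⟨0, @MeasurableSet.univ _ (F 0)⟩, by simp⟩ hgen hs hε
  exact ⟨n, t, ht, h⟩

/-- A measure-preserving map is pre-ergodic as soon as its iterates move each σ-field of a generating
sequence `F` into a σ-field independent of any prescribed member of a second generating sequence
`G`. -/
theorem MeasureTheory.MeasurePreserving.preErgodic_of_indep {Ω : Type*} {m : MeasurableSpace Ω}
    {μ : Measure Ω} [IsProbabilityMeasure μ] {f : Ω → Ω} (hf : MeasurePreserving f μ μ)
    {F G : ℕ → MeasurableSpace Ω} (hF : Monotone F) (hFm : ⨆ n, F n = m)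
    (hG : Monotone G) (hGm : ⨆ k, G k = m)
    (h : ∀ n k, ∃ j : ℕ, Indep ((F n).comap f^[j]) (G k) μ) : PreErgodic f μ := by
  refine ⟨fun s hs hfs => ?_⟩
  have hFle (n : ℕ) : F n ≤ m := hFm ▸ le_iSup F n
  have hGle (k : ℕ) : G k ≤ m := hGm ▸ le_iSup G k
  have hinv (j : ℕ) : f^[j] ⁻¹' s = s := by
    induction j with
    | zero => rfl
    | succ j ih => rw [Function.iterate_succ, Set.preimage_comp, ih, hfs]
  have key (k : ℕ) (t : Set Ω) (ht : MeasurableSet[G k] t) :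
      μ.real (s ∩ t) = μ.real s * μ.real t := by
    refine eq_of_abs_sub_nonpos (le_of_forall_pos_le_add fun ε hε => ?_)
    obtain ⟨n, b, hb, hbs⟩ := exists_measurableSet_measure_symmDiff_lt (μ := μ) hF hFm hs
      (ENNReal.ofReal_pos.2 (half_pos hε))
    obtain ⟨j, hj⟩ := h n k
    -- by invariance of `s`, the preimage of the approximating set approximates `s` equally well
    set b' := f^[j] ⁻¹' b with hb'
    have hmb' : MeasurableSet b' := (hf.iterate j).measurable (hFle n b hb)
    have hclose : μ.real (symmDiff s b') ≤ ε / 2 := by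
      have h1 : symmDiff s b' = f^[j] ⁻¹' (symmDiff b s) := by
        rw [Set.preimage_symmDiff, hinv, symmDiff_comm]
      rw [h1, Measure.real, (hf.iterate j).measure_preimage
        ((hFle n b hb).symmDiff hs).nullMeasurableSet]
      exact ENNReal.toReal_le_of_le_ofReal (half_pos hε).le hbs.le
    have hmt : MeasurableSet t := hGle k t ht
    have hmul : μ.real (b' ∩ t) = μ.real b' * μ.real t := by
      rw [Indep_iff] at hj
      simp only [Measure.real, hj b' t ⟨b, hb, rfl⟩ ht, ENNReal.toReal_mul]
    have h1 : |μ.real (s ∩ t) - μ.real (b' ∩ t)| ≤ ε / 2 := by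
      refine (abs_measureReal_sub_le_measureReal_symmDiff (hs.inter hmt).nullMeasurableSet
        (hmb'.inter hmt).nullMeasurableSet).trans ((measureReal_mono ?_).trans hclose)
      rw [← Set.inter_symmDiff_distrib_right]
      exact Set.inter_subset_left
    have h2 : |μ.real s - μ.real b'| ≤ ε / 2 :=
      (abs_measureReal_sub_le_measureReal_symmDiff hs.nullMeasurableSet
        hmb'.nullMeasurableSet).trans hclose
    have h3 : |(μ.real s - μ.real b') * μ.real t| ≤ ε / 2 := by
      rw [abs_mul, abs_of_nonneg (measureReal_nonneg (μ := μ) (s := t))]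
      exact (mul_le_of_le_one_right (abs_nonneg _) measureReal_le_one).trans h2
    have h4 : μ.real (s ∩ t) - μ.real s * μ.real t =
        (μ.real (s ∩ t) - μ.real (b' ∩ t)) - (μ.real s - μ.real b') * μ.real t := by
      rw [hmul]; ring
    rw [h4]
    linarith [abs_sub (μ.real (s ∩ t) - μ.real (b' ∩ t)) ((μ.real s - μ.real b') * μ.real t)]
  have hsle : MeasurableSpace.generateFrom {s} ≤ m :=
    MeasurableSpace.generateFrom_le (by rintro _ rfl; exact hs)
  have hind (k : ℕ) : Indep (G k) (MeasurableSpace.generateFrom {s}) μ := by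
    refine IndepSets.indep (hGle k) hsle (@MeasurableSpace.isPiSystem_measurableSet Ω (G k))
      (IsPiSystem.singleton s) (@MeasurableSpace.generateFrom_measurableSet Ω (G k)).symm rfl ?_
    rw [IndepSets_iff]
    rintro t _ ht rfl
    have := key k t ht
    rw [Set.inter_comm, mul_comm] at this
    rw [← ENNReal.toReal_eq_toReal_iff' (measure_ne_top _ _)
      (ENNReal.mul_ne_top (measure_ne_top _ _) (measure_ne_top _ _)), ENNReal.toReal_mul]
    exact this
  have hall := indep_iSup_of_monotone hind hGle hsle hG
  rw [hGm] at hall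
  rw [Filter.eventuallyConst_set']
  refine (measure_eq_zero_or_one_of_indepSet_self (hall.indepSet_of_measurableSet hs
    (MeasurableSpace.measurableSet_generateFrom rfl))).imp (fun h0 => ?_) (fun h1 => ?_)
  · exact ae_eq_empty.2 h0
  · rw [ae_eq_univ, prob_compl_eq_zero_iff hs]
    exact h1

namespace PathSpace

/-! ### Measurability on path space -/

theorem measurable_eval (x : ℝ) : Measurable (fun θ : PathSpace => θ x) :=
  Measurable.of_comap_le (le_iSup (fun x : ℝ =>
    MeasurableSpace.comap (fun θ : PathSpace => θ x) inferInstance) x)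

theorem le_of_measurable_eval {m : MeasurableSpace PathSpace}
    (h : ∀ x : ℝ, Measurable[m] (fun θ : PathSpace => θ x)) :
    instMeasurableSpace ≤ m :=
  iSup_le fun x => (h x).comap_le

theorem measurable_of_eval {α : Type*} [MeasurableSpace α] {f : α → PathSpace}
    (h : ∀ x : ℝ, Measurable (fun a => f a x)) : Measurable f := by
  refine measurable_iff_le_map.2 (le_of_measurable_eval fun x => ?_)
  exact measurable_iff_le_map.2 fun s hs => h x hs

theorem comap_pi_le {ι : Type*} {m : MeasurableSpace PathSpace} {f : PathSpace → ι → ℝ}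
    (h : ∀ i, Measurable[m] (fun θ => f θ i)) : MeasurableSpace.comap f inferInstance ≤ m :=
  (@measurable_pi_lambda _ _ _ m _ _ h).comap_le

theorem measurable_scale_uncurry :
    Measurable (fun p : ℝ × PathSpace => scale p.1 p.2) := by
  have heval : Measurable (fun p : ℝ × PathSpace => p.2 p.1) :=
    measurable_uncurry_of_continuous_of_measurable (u := fun (x : ℝ) (θ : PathSpace) => θ x)
      (fun θ => θ.continuous_toFun) measurable_eval
  refine measurable_of_eval fun x => ?_
  have h1 : Measurable (fun p : ℝ × PathSpace => (Real.exp (p.1 / 2) * x, p.2)) := by fun_prop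
  have h2 : Measurable (fun p : ℝ × PathSpace => Real.exp (-p.1 / 4)) := by fun_prop
  exact h2.mul (heval.comp h1)

theorem measurable_scale (t : ℝ) : Measurable (scale t) :=
  measurable_scale_uncurry.comp measurable_prodMk_left

theorem scale_scale_neg (t : ℝ) (θ : PathSpace) : scale t (scale (-t) θ) = θ := by
  have h := vadd_neg_vadd t θ
  rwa [vadd_eq_scale, vadd_eq_scale] at h

theorem iterate_scale (t : ℝ) (j : ℕ) : (scale t)^[j] = scale (j * t) := by
  induction j with
  | zero =>
    funext θ
    rw [Nat.cast_zero, zero_mul, ← vadd_eq_scale, zero_vadd, Function.iterate_zero, id]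
  | succ j ih =>
    funext θ
    have h := add_vadd (j * t) t θ
    simp only [vadd_eq_scale] at h
    rw [Function.iterate_succ_apply, ih, ← h]
    congr 1
    push_cast
    ring

/-! ### Invariance of Wiener measure under Brownian scaling -/

/-- The restrictions of a path to the two half-lines, both parametrised by `[0, ∞)`. -/
def halfLines (θ : PathSpace) : (ℝ≥0 → ℝ) × (ℝ≥0 → ℝ) :=
  (fun x => θ (x : ℝ), fun x => θ (-(x : ℝ)))

theorem measurable_halfLines : Measurable halfLines :=
  (measurable_pi_lambda _ fun _ => measurable_eval _).prodMk
    (measurable_pi_lambda _ fun _ => measurable_eval _)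

theorem comap_halfLines :
    MeasurableSpace.comap halfLines inferInstance = instMeasurableSpace := by
  refine le_antisymm measurable_halfLines.comap_le (le_of_measurable_eval fun x => ?_)
  have h : Measurable[MeasurableSpace.comap halfLines inferInstance] halfLines :=
    comap_measurable halfLines
  rcases le_total 0 x with hx | hx
  · lift x to ℝ≥0 using hx
    exact (measurable_pi_apply x).comp (measurable_fst.comp h)
  · obtain ⟨y, rfl⟩ : ∃ y : ℝ≥0, x = -(y : ℝ) := ⟨⟨-x, neg_nonneg.2 hx⟩, (neg_neg x).symm⟩
    exact (measurable_pi_apply y).comp (measurable_snd.comp h)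

theorem measure_ext_of_map_halfLines {μ ν : Measure PathSpace}
    (h : μ.map halfLines = ν.map halfLines) : μ = ν := by
  refine Measure.ext fun s hs => ?_
  change MeasurableSet[instMeasurableSpace] s at hs
  rw [← comap_halfLines] at hs
  obtain ⟨u, hu, rfl⟩ := hs
  rw [← Measure.map_apply measurable_halfLines hu, h, Measure.map_apply measurable_halfLines hu]

/-- Brownian scaling, at the level of the law on the space of all functions on `[0, ∞)`. -/
theorem identDistrib_brownian_scaling {Ω : Type*} {mΩ : MeasurableSpace Ω} {P : Measure Ω}
    [IsFiniteMeasure P] {B : ℝ≥0 → Ω → ℝ} (hB : IsPreBrownianReal B P) (hm : ∀ x, Measurable (B x))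
    {c : ℝ≥0} (hc : c ≠ 0) :
    IdentDistrib (fun ω x => (√c)⁻¹ * B (c * x) ω) (fun ω x => B x ω) P P := by
  have h1 : Measurable (fun ω x => (√c)⁻¹ * B (c * x) ω) :=
    measurable_pi_lambda _ fun x => (hm _).const_mul _
  have h2 : Measurable (fun ω x => B x ω) := measurable_pi_lambda _ hm
  refine ⟨h1.aemeasurable, h2.aemeasurable, ?_⟩
  refine (map_eq_iff_forall_finset_map_restrict_eq (X := fun x ω => (√c)⁻¹ * B (c * x) ω)
    (Y := B) h1.aemeasurable h2.aemeasurable).2 fun I => ?_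
  rw [((hB.smul hc).hasLaw I).map_eq, (hB.hasLaw I).map_eq]

theorem measurePreserving_scale {W : Measure PathSpace} (hW : IsWienerMeasure W) (t : ℝ) :
    MeasurePreserving (scale t) W W := by
  have := hW.isProbabilityMeasure
  refine ⟨measurable_scale t, measure_ext_of_map_halfLines ?_⟩
  rw [Measure.map_map measurable_halfLines (measurable_scale t)]
  set c : ℝ≥0 := ⟨Real.exp (t / 2), (Real.exp_pos _).le⟩ with hcdef
  have hcc : (c : ℝ) = Real.exp (t / 2) := rfl
  have hc : c ≠ 0 := by
    rw [← NNReal.coe_ne_zero, hcc]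
    exact (Real.exp_pos _).ne'
  -- `e^{-t/4}` is the normalisation `1 / √c` of Brownian scaling for the time change `c = e^{t/2}`
  have hsqrt : (√(c : ℝ))⁻¹ = Real.exp (-t / 4) := by
    rw [hcc, ← Real.exp_half, ← Real.exp_neg]
    congr 1
    ring
  have hpos := identDistrib_brownian_scaling hW.isBrownian_pos.toIsPreBrownianReal
    (fun x => measurable_eval _) hc
  have hneg := identDistrib_brownian_scaling hW.isBrownian_neg.toIsPreBrownianReal
    (fun x => measurable_eval _) hc
  have hmeas : Measurable (fun (w : ℝ≥0 → ℝ) (x : ℝ≥0) => (√(c : ℝ))⁻¹ * w (c * x)) :=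
    measurable_pi_lambda _ fun x => (measurable_pi_apply _).const_mul _
  have hind := hW.indep.comp hmeas hmeas
  refine Eq.trans ?_ (hpos.prodMk hneg hind hW.indep).map_eq
  congr 1
  funext θ
  refine Prod.ext (funext fun x => ?_) (funext fun x => ?_)
  · simp only [halfLines, Function.comp_apply, scale_apply, ← hsqrt, NNReal.coe_mul, ← hcc]
  · simp only [halfLines, Function.comp_apply, scale_apply, ← hsqrt, NNReal.coe_mul, ← hcc, mul_neg]

/-! ### Inner and outer σ-fields -/

/-- The σ-field generated by the path on `[-r, r]`. -/
abbrev inner (r : ℝ≥0) : MeasurableSpace PathSpace :=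
  MeasurableSpace.comap (fun (θ : PathSpace) (x : Set.Icc (-(r : ℝ)) r) => θ x) inferInstance

/-- The σ-field generated by the increments of the path after time `r` on the right half-line and
after time `-r`, in the outward direction, on the left half-line. -/
abbrev outer (r : ℝ≥0) : MeasurableSpace PathSpace :=
  MeasurableSpace.comap
      (fun (θ : PathSpace) (x : ℝ≥0) => θ ((r + x : ℝ≥0) : ℝ) - θ (r : ℝ)) inferInstance ⊔
    MeasurableSpace.comap
      (fun (θ : PathSpace) (x : ℝ≥0) => θ (-((r + x : ℝ≥0) : ℝ)) - θ (-(r : ℝ))) inferInstance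

theorem measurable_inner_eval {r : ℝ≥0} {x : ℝ} (hx : |x| ≤ r) :
    Measurable[inner r] (fun θ : PathSpace => θ x) :=
  (measurable_pi_apply (⟨x, abs_le.1 hx⟩ : Set.Icc (-(r : ℝ)) r)).comp
    (comap_measurable (fun (θ : PathSpace) (x : Set.Icc (-(r : ℝ)) r) => θ x))

theorem inner_le_of_measurable_eval {r : ℝ≥0} {m : MeasurableSpace PathSpace}
    (h : ∀ x : ℝ, |x| ≤ r → Measurable[m] (fun θ : PathSpace => θ x)) : inner r ≤ m :=
  comap_pi_le fun x => h x (abs_le.2 x.2)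

theorem inner_mono : Monotone inner := fun _ _ h =>
  inner_le_of_measurable_eval fun _ hx => measurable_inner_eval (hx.trans (NNReal.coe_le_coe.2 h))

theorem iSup_inner : ⨆ n : ℕ, inner n = instMeasurableSpace := by
  refine le_antisymm (iSup_le fun n => inner_le_of_measurable_eval fun x _ => measurable_eval x)
    (le_of_measurable_eval fun x => ?_)
  obtain ⟨n, hn⟩ := exists_nat_ge |x|
  exact (measurable_inner_eval (r := n) (by simpa using hn)).mono
    (le_iSup (fun n : ℕ => inner n) n) le_rfl

/-- The path `T_t θ` on `[-r, r]` is determined by `θ` on `[-e^{t/2} r, e^{t/2} r]`, an interval that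
shrinks to the origin as `t → -∞`. -/
theorem comap_scale_inner_le {t : ℝ} {r s : ℝ≥0} (h : Real.exp (t / 2) * r ≤ s) :
    (inner r).comap (scale t) ≤ inner s := by
  refine MeasurableSpace.comap_le_iff_le_map.2 (inner_le_of_measurable_eval fun x hx => ?_)
  have hx' : |Real.exp (t / 2) * x| ≤ s := by
    rw [abs_mul, Real.abs_exp]
    exact (mul_le_mul_of_nonneg_left hx (Real.exp_pos _).le).trans h
  exact measurable_iff_le_map.2 fun u hu =>
    ((measurable_inner_eval hx').const_mul (Real.exp (-t / 4))) hu

theorem measurable_outer_pos (r x : ℝ≥0) :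
    Measurable[outer r] (fun θ : PathSpace => θ ((r + x : ℝ≥0) : ℝ) - θ (r : ℝ)) := by
  have h : Measurable[outer r]
      (fun (θ : PathSpace) (x : ℝ≥0) => θ ((r + x : ℝ≥0) : ℝ) - θ (r : ℝ)) :=
    (comap_measurable _).mono le_sup_left le_rfl
  exact (measurable_pi_apply x).comp h

theorem measurable_outer_neg (r x : ℝ≥0) :
    Measurable[outer r] (fun θ : PathSpace => θ (-((r + x : ℝ≥0) : ℝ)) - θ (-(r : ℝ))) := by
  have h : Measurable[outer r]
      (fun (θ : PathSpace) (x : ℝ≥0) => θ (-((r + x : ℝ≥0) : ℝ)) - θ (-(r : ℝ))) :=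
    (comap_measurable _).mono le_sup_right le_rfl
  exact (measurable_pi_apply x).comp h

theorem outer_le (r : ℝ≥0) : outer r ≤ instMeasurableSpace :=
  sup_le
    (comap_pi_le fun _ => (measurable_eval _).sub (measurable_eval _))
    (comap_pi_le fun _ => (measurable_eval _).sub (measurable_eval _))

theorem outer_anti : Antitone outer := by
  intro r s hrs
  obtain ⟨d, rfl⟩ := exists_add_of_le hrs
  have hsub {f g : PathSpace → ℝ} (hf : Measurable[outer r] f) (hg : Measurable[outer r] g) :
      Measurable[outer r] (fun θ => f θ - g θ) :=
    Measurable.fun_sub (m := outer r) hf hg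
  refine sup_le (comap_pi_le fun x => ?_) (comap_pi_le fun x => ?_)
  · convert hsub (measurable_outer_pos r (d + x)) (measurable_outer_pos r d) using 2 with θ
    simp [add_assoc]
  · convert hsub (measurable_outer_neg r (d + x)) (measurable_outer_neg r d) using 2 with θ
    simp [add_assoc]

/-- Since paths are continuous and vanish at the origin, increments taken away from the origin
determine the whole path. -/
theorem iSup_outer :
    ⨆ k : ℕ, outer (1 / (k + 1)) = instMeasurableSpace := by
  refine le_antisymm (iSup_le fun k => outer_le _) (le_of_measurable_eval fun x => ?_)
  have hδ : Tendsto (fun k : ℕ => (1 / (k + 1) : ℝ≥0)) atTop (𝓝 0) :=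
    tendsto_one_div_add_atTop_nhds_zero_nat
  have hmax (y : ℝ≥0) :
      Tendsto (fun k : ℕ => ((1 / (k + 1) + (y - 1 / (k + 1)) : ℝ≥0) : ℝ)) atTop (𝓝 (y : ℝ)) := by
    simp only [add_tsub_eq_max]
    have := hδ.max (tendsto_const_nhds (x := y))
    rw [max_eq_right zero_le] at this
    exact NNReal.tendsto_coe.2 this
  have hδ' : Tendsto (fun k : ℕ => ((1 / (k + 1) : ℝ≥0) : ℝ)) atTop (𝓝 0) :=
    NNReal.tendsto_coe.2 hδ
  have hle (k : ℕ) : outer (1 / (k + 1)) ≤ ⨆ k : ℕ, outer (1 / (k + 1)) :=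
    le_iSup (fun k : ℕ => outer (1 / (k + 1))) k
  rcases le_total 0 x with hx | hx
  · lift x to ℝ≥0 using hx
    refine @measurable_of_tendsto_metrizable _ _ (⨆ k : ℕ, outer (1 / (k + 1))) _ _ _ _ _ _
      (fun k => (measurable_outer_pos (1 / (k + 1)) (x - 1 / (k + 1))).mono (hle k) le_rfl)
      (tendsto_pi_nhds.2 fun θ => ?_)
    have hc : Continuous θ := θ.continuous_toFun
    have h0 : θ 0 = 0 := θ.map_zero_toFun
    simpa [h0] using ((hc.tendsto _).comp (hmax x)).sub ((hc.tendsto _).comp hδ')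
  · obtain ⟨y, rfl⟩ : ∃ y : ℝ≥0, x = -(y : ℝ) := ⟨⟨-x, neg_nonneg.2 hx⟩, (neg_neg x).symm⟩
    refine @measurable_of_tendsto_metrizable _ _ (⨆ k : ℕ, outer (1 / (k + 1))) _ _ _ _ _ _
      (fun k => (measurable_outer_neg (1 / (k + 1)) (y - 1 / (k + 1))).mono (hle k) le_rfl)
      (tendsto_pi_nhds.2 fun θ => ?_)
    have hc : Continuous θ := θ.continuous_toFun
    have h0 : θ 0 = 0 := θ.map_zero_toFun
    have h1 := ((hc.tendsto _).comp (hmax y).neg).sub ((hc.tendsto _).comp hδ'.neg)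
    rw [neg_zero, h0, sub_zero] at h1
    exact h1

/-- The weak Markov property at time `r` on each half-line, combined with the independence of the
two half-lines. -/
theorem indep_inner_outer {W : Measure PathSpace} (hW : IsWienerMeasure W) (r : ℝ≥0) :
    Indep (inner r) (outer r) W := by
  have := hW.isProbabilityMeasure
  have hpos := (hW.isBrownian_pos.toIsPreBrownianReal.indepFun_shift r).symm
  have hneg := (hW.isBrownian_neg.toIsPreBrownianReal.indepFun_shift r).symm
  have hind := hW.indep
  rw [IndepFun_iff_Indep] at hpos hneg hind
  have hm (g : ℝ≥0 → ℝ) (x : ℝ≥0) : Measurable[MeasurableSpace.comap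
      (fun (θ : PathSpace) (x : ℝ≥0) => θ (g x)) inferInstance] (fun θ : PathSpace => θ (g x)) :=
    (measurable_pi_apply x).comp (comap_measurable (fun (θ : PathSpace) (x : ℝ≥0) => θ (g x)))
  have hle (g : ℝ≥0 → ℝ) : MeasurableSpace.comap
      (fun (θ : PathSpace) (x : ℝ≥0) => θ (g x)) inferInstance ≤
        instMeasurableSpace :=
    comap_pi_le fun _ => measurable_eval _
  have hin (g : ℝ≥0 → ℝ) : MeasurableSpace.comap
      (fun (θ : PathSpace) (x : Set.Iic r) => θ (g x)) inferInstance ≤ MeasurableSpace.comap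
      (fun (θ : PathSpace) (x : ℝ≥0) => θ (g x)) inferInstance :=
    comap_pi_le fun x => hm g x
  have hout (g : ℝ≥0 → ℝ) : MeasurableSpace.comap
      (fun (θ : PathSpace) (x : ℝ≥0) => θ (g (r + x)) - θ (g r)) inferInstance ≤
      MeasurableSpace.comap (fun (θ : PathSpace) (x : ℝ≥0) => θ (g x)) inferInstance :=
    comap_pi_le fun x => Measurable.fun_sub (m := MeasurableSpace.comap _ inferInstance)
      (hm g (r + x)) (hm g r)
  have hIic (g : ℝ≥0 → ℝ) (x : ℝ≥0) (hx : x ≤ r) : Measurable[MeasurableSpace.comap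
      (fun (θ : PathSpace) (x : Set.Iic r) => θ (g x)) inferInstance] (fun θ => θ (g x)) :=
    (measurable_pi_apply (⟨x, hx⟩ : Set.Iic r)).comp
      (comap_measurable (fun (θ : PathSpace) (x : Set.Iic r) => θ (g x)))
  refine indep_of_indep_of_le_left (hind.sup_sup (hle _) (hle _) (hin (fun x => x))
    (hout (fun x => x)) (hin (fun x => -x)) (hout (fun x => -x)) hpos hneg) ?_
  refine inner_le_of_measurable_eval fun x hx => ?_
  rcases le_total 0 x with h | h
  · lift x to ℝ≥0 using h
    rw [NNReal.abs_eq, NNReal.coe_le_coe] at hx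
    exact (hIic (fun x => x) x hx).mono le_sup_left le_rfl
  · obtain ⟨y, rfl⟩ : ∃ y : ℝ≥0, x = -(y : ℝ) := ⟨⟨-x, neg_nonneg.2 h⟩, (neg_neg x).symm⟩
    rw [abs_neg, NNReal.abs_eq, NNReal.coe_le_coe] at hx
    exact (hIic (fun x => -x) y hx).mono le_sup_right le_rfl

/-! ### Ergodicity -/

theorem preErgodic_scale_of_neg {W : Measure PathSpace} (hW : IsWienerMeasure W) {t : ℝ}
    (ht : t < 0) : PreErgodic (scale t) W := by
  have := hW.isProbabilityMeasure
  refine (measurePreserving_scale hW t).preErgodic_of_indep (F := fun n : ℕ => inner n)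
    (G := fun k : ℕ => outer (1 / (k + 1))) (fun a b h => inner_mono (Nat.cast_le.2 h)) iSup_inner
    (fun a b h => outer_anti ?_) iSup_outer (fun n k => ?_)
  · exact one_div_le_one_div_of_le (by positivity) (by gcongr)
  · -- for large `j` the time change `e^{jt/2}` maps `[-n, n]` into `[-1/(k+1), 1/(k+1)]`
    have h1 : Tendsto (fun j : ℕ => Real.exp (j * t / 2) * n) atTop (𝓝 0) := by
      have h2 : Tendsto (fun j : ℕ => (j : ℝ) * t / 2) atTop atBot :=
        (tendsto_natCast_atTop_atTop.atTop_mul_const_of_neg ht).atBot_div_const two_pos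
      simpa using (Real.tendsto_exp_atBot.comp h2).mul_const (n : ℝ)
    have h3 : (0 : ℝ) < ((1 / (k + 1) : ℝ≥0) : ℝ) := by positivity
    obtain ⟨j, hj⟩ := (h1.eventually (gt_mem_nhds h3)).exists
    refine ⟨j, indep_of_indep_of_le_left (indep_inner_outer hW _) ?_⟩
    rw [iterate_scale]
    exact comap_scale_inner_le (by simpa using hj.le)

theorem ergodic_scale {W : Measure PathSpace} (hW : IsWienerMeasure W) {t : ℝ} (ht : t ≠ 0) :
    Ergodic (scale t) W := by
  refine ⟨measurePreserving_scale hW t, ?_⟩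
  rcases ht.lt_or_gt with ht | ht
  · exact preErgodic_scale_of_neg hW ht
  · -- a set invariant under `T_t` is invariant under its inverse `T_{-t}`
    refine ⟨fun s hs hinv => (preErgodic_scale_of_neg hW (neg_lt_zero.2 ht)).aeconst_set hs ?_⟩
    ext θ
    rw [Set.mem_preimage, ← hinv, Set.mem_preimage, scale_scale_neg, hinv]

end PathSpace

theorem mainTheorem7 (W : Measure PathSpace) (hW : IsWienerMeasure W) :
    -- `(t, θ) ↦ T_t θ` is a measurable flow preserving `W`
    Measurable (fun p : ℝ × PathSpace => PathSpace.scale p.1 p.2) ∧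
    (∀ t : ℝ, MeasurePreserving (PathSpace.scale t) W W) ∧
    -- the flow `(T_t)_{t ∈ ℝ}` is ergodic
    ErgodicVAdd ℝ PathSpace W ∧
    -- and so is each single transformation `T_t` with `t ≠ 0`
    (∀ t : ℝ, t ≠ 0 → Ergodic (PathSpace.scale t) W) := by
  refine ⟨PathSpace.measurable_scale_uncurry, PathSpace.measurePreserving_scale hW, ?_,
    fun t ht => PathSpace.ergodic_scale hW ht⟩
  exact
    { measure_preimage_vadd := fun t s hs =>
        (PathSpace.measurePreserving_scale hW t).measure_preimage hs.nullMeasurableSet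
      -- ergodicity of the flow follows from that of its time-one map
      aeconst_of_forall_preimage_vadd_ae_eq := fun hs h =>
        (PathSpace.ergodic_scale hW one_ne_zero).quasiErgodic.aeconst_set₀ hs.nullMeasurableSet
          (h 1) }
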